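/- For $\alpha\in\overline{\mathbb{Q}}$ let $h(\alpha)$ be the absolute logarithmic Weil height of $\alpha$. For a subset $S\subseteq\overline{\mathbb{Q}}$ define its Northcott number (with respect to $h$) by $$\mathcal N(S)=\inf\{t\in[0,\infty) : \text{there are infinitely many } \alpha\in S \text{ with } h(\alpha)<t\}\in[0,\infty],$$ where $\inf\emptyset=\infty$. Lemma. Let $C>0$ be a real constant and let $K$ be a number field with a fixed algebraic closure $\overline{K}=\overline{\mathbb{Q}}$. Then there are uncountably many algebraic extensions $F$ of $K$ (that is, uncountably many distinct fields $F$ with $K\subseteq F\subseteq\overline{\mathbb{Q}}$) such that $\mathcal N(F)>C$. -/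

import Mathlib

open scoped NNReal ENNReal

/-- The Northcott number of a set `S` with respect to a (nonnegative) function `f`: the infimum in
`[0, ∞]` of all `t ∈ [0, ∞)` such that `f a < t` for infinitely many `a ∈ S`, with the
convention `inf ∅ = ∞`. -/
noncomputable def northcottNumberWith {α : Type*} (f : α → ℝ) (S : Set α) : ℝ≥0∞ :=
  sInf {t : ℝ≥0∞ | ∃ r : ℝ≥0, t = r ∧ {a : α | a ∈ S ∧ f a < r}.Infinite}

/-- The Northcott number of a set of algebraic numbers with respect to the absolute logarithmic
Weil height. -/
noncomputable def northcottNumber {Ω : Type*} [Field Ω] [CharZero Ω] (S : Set Ω) : ℝ≥0∞ :=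
  northcottNumberWith (fun x : Ω => NumberField.absLogHeight₁ x) S

/-! Square roots x₀, x₁, … of elements of K are chosen so that no step K(x₀,…,xₙ₋₁) ⊂ K(x₀,…,xₙ)
adds an element of height at most B = C + 1. Elements of any quadratic extension of a number field M
have bounded degree, so by Northcott only finitely many have height at most B. By exchange, a new
one would generate the extension over M, so it suffices that the new root avoid the finite extension
of M generated by all these candidates. Such a root exists because a number field cannot contain √p
for every prime p. For every S ⊆ ℕ, the elements of K(xᵢ : i ∈ S) of height at most B then lie in K
and are finite in number. Distinct S give distinct fields, and Cantor's theorem concludes. -/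

/-! ### Square roots and field generation -/

section quadratic

open Polynomial IntermediateField

/-- An element of `F(y)` with `y ^ 2 ∈ F` has the form `a + b y` with `a, b ∈ F`. -/
lemma exists_eq_add_mul_of_mem_adjoin_sqrt {F E : Type*} [Field F] [Field E] [Algebra F E]
    {y t : E} {c : F} (hy : y ^ 2 = algebraMap F E c) (ht : t ∈ F⟮y⟯) :
    ∃ a b : F, t = algebraMap F E a + algebraMap F E b * y := by
  have hmon : (X ^ 2 - C c : F[X]).Monic := monic_X_pow_sub_C c two_ne_zero
  have hroot : aeval y (X ^ 2 - C c : F[X]) = 0 := by simp [hy]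
  have halg : IsAlgebraic F y := ⟨_, hmon.ne_zero, hroot⟩
  rw [← mem_toSubalgebra, adjoin_simple_toSubalgebra_of_isAlgebraic halg,
    Algebra.adjoin_singleton_eq_range_aeval] at ht
  obtain ⟨p, rfl⟩ := ht
  have hdeg : (p %ₘ (X ^ 2 - C c)).natDegree ≤ 1 := by
    have h := natDegree_modByMonic_lt p hmon fun h ↦ by
      simpa [natDegree_X_pow_sub_C] using congrArg natDegree h
    rw [natDegree_X_pow_sub_C] at h
    lia
  refine ⟨(p %ₘ (X ^ 2 - C c)).coeff 0, (p %ₘ (X ^ 2 - C c)).coeff 1, ?_⟩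
  change aeval y p = _
  rw [← aeval_modByMonic_eq_self_of_root hroot, add_comm]
  conv_lhs => rw [eq_X_add_C_of_natDegree_le_one hdeg]
  simp

/-- The exchange property for adjoining square roots. -/
lemma mem_adjoin_insert_of_mem_adjoin_insert_sqrt {F E : Type*} [Field F] [Field E] [Algebra F E]
    {A : Set E} {y t : E} (hy : y ^ 2 ∈ adjoin F A) (ht : t ∈ adjoin F (insert y A))
    (ht' : t ∉ adjoin F A) : y ∈ adjoin F (insert t A) := by
  have key : t ∈ (adjoin F A)⟮y⟯ := by
    rw [← mem_restrictScalars F, adjoin_adjoin_left, Set.union_singleton]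
    exact ht
  obtain ⟨a, b, h⟩ := exists_eq_add_mul_of_mem_adjoin_sqrt (c := (⟨_, hy⟩ : adjoin F A)) rfl key
  have hb : (b : E) ≠ 0 := by
    intro hb
    apply ht'
    rw [h]
    simp [hb]
  have hle : adjoin F A ≤ adjoin F (insert t A) := adjoin.mono F _ _ (Set.subset_insert _ _)
  have : y = (t - a) / b := by
    rw [h]
    simp only [IntermediateField.algebraMap_apply]
    field_simp
    ring
  rw [this]
  exact div_mem (sub_mem (subset_adjoin F _ (Set.mem_insert _ _)) (hle a.2)) (hle b.2)

lemma not_isSquare_prime_mul_prime {p q : ℕ} (hp : p.Prime) (hq : q.Prime) (hpq : p ≠ q) :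
    ¬ IsSquare (p * q) := by
  rintro ⟨r, hr⟩
  have hpr : p ∣ r := by
    have : p ∣ r * r := hr ▸ dvd_mul_right p q
    exact (hp.dvd_mul.mp this).elim id id
  obtain ⟨s, rfl⟩ := hpr
  have h : q = p * (s * s) := by
    apply Nat.eq_of_mul_eq_mul_left hp.pos
    rw [hr]; ring
  have : p ∣ q := ⟨_, h⟩
  exact hpq ((Nat.prime_dvd_prime_iff_eq hp hq).mp this)

/-- A finite extension of `ℚ` does not contain the square roots of all primes. -/
lemma exists_prime_forall_sq_ne (M : Type*) [Field M] [NumberField M] :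
    ∃ p : ℕ, p.Prime ∧ ∀ y : M, y ^ 2 ≠ p := by
  by_contra! H
  have : Finite (IntermediateField ℚ M) :=
    Field.finite_intermediateField_of_exists_primitive_element ℚ M
      (Field.exists_primitive_element ℚ M)
  choose f hf using fun p : Nat.Primes ↦ H p p.2
  -- M has finitely many subfields, so two distinct primes give ℚ(√p) = ℚ(√q).
  obtain ⟨p, q, hpq, h⟩ := Finite.exists_ne_map_eq_of_infinite fun p : Nat.Primes ↦ ℚ⟮f p⟯
  have hq : f q ∈ ℚ⟮f p⟯ := by
    simp only [h]
    exact mem_adjoin_simple_self ℚ _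
  have hp : f p ^ 2 = algebraMap ℚ M (p : ℕ) := by simp [hf]
  obtain ⟨a, b, hab⟩ := exists_eq_add_mul_of_mem_adjoin_sqrt hp hq
  have hprime (p : Nat.Primes) (r : ℚ) : r ^ 2 ≠ (p : ℕ) := fun hr ↦
    p.2.prime.not_isSquare (Rat.isSquare_natCast_iff.mp ⟨r, by rw [← hr, sq]⟩)
  have hpM (r : ℚ) : f p ≠ r := fun hr ↦ by
    apply hprime p r
    have := hf p
    rw [hr] at this
    exact_mod_cast this
  simp only [eq_ratCast] at hab
  have hsq : ((q : ℕ) : M) = a ^ 2 + b ^ 2 * (p : ℕ) + 2 * a * b * f p := by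
    rw [← hf q, hab, ← hf p]; ring
  -- For √q = a + b√p: a = 0 makes pq a square, b = 0 makes q a square, and ab ≠ 0 makes √p
  -- rational.
  by_cases h0 : a * b = 0
  · rcases mul_eq_zero.mp h0 with ha | hb
    · have h1 : ((q : ℕ) : ℚ) = b ^ 2 * (p : ℕ) := by
        simp only [ha] at hsq
        simp at hsq
        exact_mod_cast hsq
      refine not_isSquare_prime_mul_prime p.2 q.2 (fun h ↦ hpq (Subtype.ext h))
        (Rat.isSquare_natCast_iff.mp ⟨b * (p : ℕ), ?_⟩)
      push_cast
      rw [h1]; ring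
    · apply hprime q a
      simp only [hb] at hsq
      simp at hsq
      exact_mod_cast hsq.symm
  · apply hpM (((q : ℕ) - a ^ 2 - b ^ 2 * (p : ℕ)) / (2 * (a * b)))
    have h0' : ((a * b : ℚ) : M) ≠ 0 := by exact_mod_cast h0
    push_cast at h0' ⊢
    rw [eq_div_iff (by simpa using h0'), hsq]
    ring

end quadratic

/-! ### Northcott's theorem -/

section northcott

open NumberField IntermediateField

lemma norm_embedding_le_mulHeight₁ {L : Type*} [Field L] [NumberField L] (x : L) (φ : L →+* ℂ) :
    ‖φ x‖ ≤ Height.mulHeight₁ x := by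
  set v := InfinitePlace.mk φ
  have hv : ‖φ x‖ = v x := rfl
  rw [hv, NumberField.mulHeight₁_eq]
  have h1 : v x ≤ max (v x) 1 ^ v.mult :=
    (le_max_left _ _).trans (le_self_pow₀ (le_max_right _ _) v.mult_ne_zero)
  have h2 : max (v x) 1 ^ v.mult ≤ ∏ w : InfinitePlace L, max (w x) 1 ^ w.mult :=
    (Finset.le_prod_max_one (Finset.mem_univ v) fun w : InfinitePlace L ↦
      max (w x) 1 ^ w.mult).trans_eq <| Finset.prod_congr rfl fun w _ ↦
        max_eq_left (one_le_pow₀ (le_max_right _ _))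
  refine (h1.trans h2).trans (le_mul_of_one_le_right (by positivity) ?_)
  exact one_le_finprod fun _ ↦ le_max_right _ _

/-- Algebraic integers of bounded degree with bounded conjugates form a finite set. -/
lemma finite_isIntegral_norm_le (Ω : Type*) [Field Ω] [CharZero Ω] (D : ℕ) (B : ℝ) :
    {x : Ω | IsIntegral ℤ x ∧ Module.finrank ℚ ℚ⟮x⟯ ≤ D ∧
      ∀ φ : ℚ⟮x⟯ →+* ℂ, ‖φ (AdjoinSimple.gen ℚ x)‖ ≤ B}.Finite := by
  classical
  let C := Nat.ceil (max B 1 ^ D * (D.choose (D / 2)))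
  have := Polynomial.bUnion_roots_finite (algebraMap ℤ Ω) D (Set.finite_Icc (-C : ℤ) C)
  refine this.subset fun x ⟨hx, hD, hB⟩ => ?_
  simp_rw [Set.mem_iUnion]
  have hxQ : IsIntegral ℚ x := hx.tower_top
  have : FiniteDimensional ℚ ℚ⟮x⟯ := adjoin.finiteDimensional hxQ
  have : NumberField ℚ⟮x⟯ := {}
  have hmin := minpoly.isIntegrallyClosed_eq_field_fractions' ℚ hx
  refine ⟨_, ⟨?_, fun i => ?_⟩, Polynomial.mem_rootSet.2 ⟨minpoly.ne_zero hx, minpoly.aeval ℤ x⟩⟩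
  · rw [← (minpoly.monic hx).natDegree_map (algebraMap ℤ ℚ), ← hmin, ← adjoin.finrank hxQ]
    exact hD
  have hb : ‖(minpoly ℚ x).coeff i‖ ≤ max B 1 ^ Module.finrank ℚ ℚ⟮x⟯ *
      (Module.finrank ℚ ℚ⟮x⟯).choose (Module.finrank ℚ ℚ⟮x⟯ / 2) := by
    rw [← minpoly_gen ℚ x]
    convert! Embeddings.coeff_bdd_of_norm_le hB i
  rw [Set.mem_Icc, ← abs_le, ← @Int.cast_le ℝ]
  refine (Eq.trans_le ?_ <| hb.trans ?_).trans (Nat.le_ceil _)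
  · rw [hmin, Polynomial.coeff_map, eq_intCast, Int.norm_cast_rat, Int.norm_eq_abs,
      Int.cast_abs]
  · have hch : (Module.finrank ℚ ℚ⟮x⟯).choose (Module.finrank ℚ ℚ⟮x⟯ / 2) ≤ D.choose (D / 2) :=
      (Nat.choose_le_choose _ hD).trans (Nat.choose_le_middle _ _)
    gcongr
    exact le_max_right _ _

/-- **Northcott's theorem**: there are only finitely many algebraic numbers of bounded degree and
bounded height. -/
lemma finite_absLogHeight₁_le (Ω : Type*) [Field Ω] [CharZero Ω] (D : ℕ) (B : ℝ) :
    {x : Ω | IsIntegral ℚ x ∧ Module.finrank ℚ ℚ⟮x⟯ ≤ D ∧ absLogHeight₁ x ≤ B}.Finite := by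
  -- Bounds the relative height in every degree up to D; `max B 0` keeps the bound monotone in the
  -- degree.
  set H : ℝ := Real.exp (D * max B 0) with hH
  have hfin := Set.Finite.biUnion (Set.finite_Icc 1 ⌊H⌋₊) fun n _ ↦
    (finite_isIntegral_norm_le Ω D (H * H)).image fun y : Ω ↦ y / (n : Ω)
  refine hfin.subset fun x ⟨hx, hD, hB⟩ ↦ ?_
  have : FiniteDimensional ℚ ℚ⟮x⟯ := adjoin.finiteDimensional hx
  have : NumberField ℚ⟮x⟯ := {}
  set g := AdjoinSimple.gen ℚ x with hg
  have hHx : Height.mulHeight₁ g ≤ H := by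
    have h1 : absLogHeight₁ x = (Module.finrank ℚ ℚ⟮x⟯ : ℝ)⁻¹ * Real.log (Height.mulHeight₁ g) := by
      rw [absLogHeight₁, absMulHeight₁, dif_pos hx, Real.log_rpow (Height.mulHeight₁_pos _)]
    have hpos : (0 : ℝ) < Module.finrank ℚ ℚ⟮x⟯ := by exact_mod_cast Module.finrank_pos
    rw [hH, ← Real.log_le_iff_le_exp (Height.mulHeight₁_pos _)]
    rw [h1, inv_mul_le_iff₀ hpos] at hB
    have hD' : (Module.finrank ℚ ℚ⟮x⟯ : ℝ) ≤ D := by exact_mod_cast hD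
    calc _ ≤ _ := hB
      _ ≤ (Module.finrank ℚ ℚ⟮x⟯ : ℝ) * max B 0 := by gcongr; exact le_max_left _ _
      _ ≤ _ := by gcongr
  -- Clearing denominators costs a factor n ≤ H, so the conjugates of the integer nx are bounded by
  -- H * H.
  obtain ⟨n, hn0, hn, hint⟩ := exists_nat_le_mulHeight₁ g
  have hnΩ : (n : Ω) ≠ 0 := by exact_mod_cast hn0
  have hcoe : ((n * g : ℚ⟮x⟯) : Ω) = n * x := by simp [hg]
  have hadj : ℚ⟮(n : Ω) * x⟯ = ℚ⟮x⟯ := by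
    have hnm (F : IntermediateField ℚ Ω) : (n : Ω) ∈ F := _root_.natCast_mem F n
    apply le_antisymm
    · rw [adjoin_simple_le_iff]
      exact mul_mem (hnm _) (mem_adjoin_simple_self ℚ x)
    · rw [adjoin_simple_le_iff]
      have := div_mem (mem_adjoin_simple_self ℚ ((n : Ω) * x)) (hnm _)
      rwa [mul_div_cancel_left₀ _ hnΩ] at this
  simp only [Set.mem_iUnion]
  refine ⟨n, ⟨Nat.one_le_iff_ne_zero.mpr hn0, Nat.le_floor (hn.trans hHx)⟩,
    n * x, ⟨?_, by rwa [hadj], fun φ ↦ ?_⟩, by field_simp⟩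
  · rw [← hcoe]
    exact hint.map (algebraMap ℚ⟮x⟯ Ω).toIntAlgHom
  · let e := equivOfEq hadj.symm
    have he : e (n * g) = AdjoinSimple.gen ℚ ((n : Ω) * x) := by
      apply Subtype.ext
      exact hcoe
    rw [← he]
    change ‖(φ.comp (e : ℚ⟮x⟯ →+* ℚ⟮(n : Ω) * x⟯)) (n * g)‖ ≤ _
    rw [map_mul, norm_mul, map_natCast, Complex.norm_natCast]
    have := norm_embedding_le_mulHeight₁ g (φ.comp (e : ℚ⟮x⟯ →+* ℚ⟮(n : Ω) * x⟯))
    gcongr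
    · exact hn.trans hHx
    · exact this.trans hHx

end northcott

/-- Every admissible `r` is at least `B`; the gap between `C` and `B` makes the inequality strict.
-/
lemma lt_northcottNumberWith_of_finite {α : Type*} {f : α → ℝ} {S : Set α} {C B : ℝ} (hC : 0 ≤ C)
    (hCB : C < B) (h : {a : α | a ∈ S ∧ f a ≤ B}.Finite) :
    ENNReal.ofReal C < northcottNumberWith f S := by
  refine ((ENNReal.ofReal_lt_ofReal_iff (hC.trans_lt hCB)).mpr hCB).trans_le (le_sInf ?_)
  rintro _ ⟨r, rfl, hr⟩
  rw [← ENNReal.ofReal_coe_nnreal]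
  refine ENNReal.ofReal_le_ofReal (le_of_not_gt fun hrB ↦ hr (h.subset ?_))
  exact fun a ha ↦ ⟨ha.1, (ha.2.trans hrB).le⟩

/-! ### The tower of quadratic extensions -/

section tower

open NumberField IntermediateField

variable {K Ω : Type*} [Field K] [NumberField K] [Field Ω] [CharZero Ω] [Algebra K Ω]

lemma numberField_of_finiteDimensional (M : IntermediateField K Ω) [FiniteDimensional K M] :
    NumberField M where
  to_charZero := charZero_of_injective_algebraMap (algebraMap K M).injective
  to_finiteDimensional :=
    have : CharZero M := charZero_of_injective_algebraMap (algebraMap K M).injective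
    FiniteDimensional.trans ℚ K M

lemma finiteDimensional_adjoin_of_finite {K Ω : Type*} [Field K] [Field Ω] [Algebra K Ω]
    [Algebra.IsAlgebraic K Ω] {s : Set Ω} (hs : s.Finite) :
    FiniteDimensional K (adjoin K s) :=
  have := hs.to_subtype
  IntermediateField.finiteDimensional_adjoin fun x _ ↦ Algebra.IsIntegral.isIntegral x

/-- No finite extension of a number field contains the square roots of all primes. -/
lemma exists_sqrt_notMem [IsAlgClosed Ω] (M : IntermediateField K Ω) [FiniteDimensional K M] :
    ∃ y : Ω, (∃ c : K, y ^ 2 = algebraMap K Ω c) ∧ y ∉ M := by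
  have := numberField_of_finiteDimensional M
  obtain ⟨p, -, hp⟩ := exists_prime_forall_sq_ne M
  obtain ⟨y, hy⟩ := IsAlgClosed.exists_pow_nat_eq (p : Ω) two_pos
  refine ⟨y, ⟨p, by simp [hy]⟩, fun hyM ↦ hp ⟨y, hyM⟩ (Subtype.ext ?_)⟩
  simpa using hy

lemma finrank_rat_adjoin_le_of_mem_adjoin_sqrt {y t : Ω} {c : K} (hy : y ^ 2 = algebraMap K Ω c)
    (ht : t ∈ K⟮y⟯) :
    IsIntegral ℚ t ∧ Module.finrank ℚ ℚ⟮t⟯ ≤ Module.finrank ℚ K * 2 := by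
  have hmon := Polynomial.monic_X_pow_sub_C c two_ne_zero
  have hroot : Polynomial.aeval y (Polynomial.X ^ 2 - Polynomial.C c) = 0 := by
    simp [hy]
  have hint : IsIntegral K y := ⟨_, hmon, hroot⟩
  have := adjoin.finiteDimensional hint
  have := numberField_of_finiteDimensional K⟮y⟯
  have hdeg : Module.finrank K K⟮y⟯ ≤ 2 := by
    rw [adjoin.finrank hint]
    refine (Polynomial.natDegree_le_of_dvd (minpoly.dvd _ _ hroot) hmon.ne_zero).trans ?_
    rw [Polynomial.natDegree_X_pow_sub_C]
  let t' : K⟮y⟯ := ⟨t, ht⟩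
  have ht' : IsIntegral ℚ t' := Algebra.IsIntegral.isIntegral t'
  have htint : IsIntegral ℚ t := ht'.map (algebraMap K⟮y⟯ Ω).toRatAlgHom
  refine ⟨htint, ?_⟩
  rw [adjoin.finrank htint]
  have hmin : minpoly ℚ t = minpoly ℚ t' :=
    minpoly.algHom_eq (algebraMap K⟮y⟯ Ω).toRatAlgHom (algebraMap K⟮y⟯ Ω).injective t'
  rw [hmin]
  refine (minpoly.natDegree_le t').trans ?_
  rw [← Module.finrank_mul_finrank ℚ K K⟮y⟯]
  exact Nat.mul_le_mul_left _ hdeg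

lemma finrank_rat_adjoin_le_of_mem_adjoin_insert_sqrt {A : Set Ω} [FiniteDimensional K (adjoin K A)]
    {y t : Ω} (hy : y ^ 2 ∈ adjoin K A) (ht : t ∈ adjoin K (insert y A)) :
    IsIntegral ℚ t ∧ Module.finrank ℚ ℚ⟮t⟯ ≤ Module.finrank ℚ (adjoin K A) * 2 := by
  have := numberField_of_finiteDimensional (adjoin K A)
  refine finrank_rat_adjoin_le_of_mem_adjoin_sqrt (K := adjoin K A) (c := ⟨_, hy⟩) rfl ?_
  rw [← mem_restrictScalars K, adjoin_adjoin_left, Set.union_singleton]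
  exact ht

/-- Over a finitely generated algebraic extension of a number field there is a quadratic extension
without new elements of height at most `B`. -/
lemma exists_sqrt_forall_height_le [IsAlgClosed Ω] [Algebra.IsAlgebraic K Ω] (B : ℝ) {s : Set Ω}
    (hs : s.Finite) :
    ∃ y : Ω, (∃ c : K, y ^ 2 = algebraMap K Ω c) ∧ y ∉ adjoin K s ∧
      ∀ t ∈ adjoin K (insert y s), absLogHeight₁ t ≤ B → t ∈ adjoin K s := by
  have := finiteDimensional_adjoin_of_finite (K := K) hs
  set T := {x : Ω | IsIntegral ℚ x ∧ Module.finrank ℚ ℚ⟮x⟯ ≤ Module.finrank ℚ (adjoin K s) * 2 ∧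
    absLogHeight₁ x ≤ B}
  have hT : T.Finite := finite_absLogHeight₁_le Ω _ B
  have := finiteDimensional_adjoin_of_finite (K := K) (hs.union hT)
  obtain ⟨y, ⟨c, hc⟩, hy⟩ := exists_sqrt_notMem (adjoin K (s ∪ T))
  have hy2 : y ^ 2 ∈ adjoin K s := hc ▸ IntermediateField.algebraMap_mem _ c
  refine ⟨y, ⟨c, hc⟩, fun h ↦ hy (adjoin.mono K _ _ Set.subset_union_left h), fun t ht htB ↦ ?_⟩
  by_contra hts
  obtain ⟨h1, h2⟩ := finrank_rat_adjoin_le_of_mem_adjoin_insert_sqrt hy2 ht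
  -- A new `t` of small height lies in `T`, and exchange would put `y` in K(s ∪ T).
  refine hy (adjoin.mono K _ _ ?_ (mem_adjoin_insert_of_mem_adjoin_insert_sqrt hy2 ht hts))
  exact Set.insert_subset (Or.inr ⟨h1, h2, htB⟩) Set.subset_union_left

lemma exists_seq_sqrt [IsAlgClosed Ω] [Algebra.IsAlgebraic K Ω] (B : ℝ) :
    ∃ x : ℕ → Ω, (∀ n, ∃ c : K, x n ^ 2 = algebraMap K Ω c) ∧
      (∀ n, x n ∉ adjoin K (x '' Set.Iio n)) ∧
      ∀ n, ∀ t ∈ adjoin K (x '' Set.Iio (n + 1)), absLogHeight₁ t ≤ B →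
        t ∈ adjoin K (x '' Set.Iio n) := by
  classical
  choose f hf using fun s : Finset Ω ↦ exists_sqrt_forall_height_le (K := K) B s.finite_toSet
  let S (n : ℕ) : Finset Ω := Nat.rec (motive := fun _ ↦ Finset Ω) ∅ (fun _ s ↦ insert (f s) s) n
  have hS (n : ℕ) : ((S n : Finset Ω) : Set Ω) = (fun n ↦ f (S n)) '' Set.Iio n := by
    induction n with
    | zero => simp [S]
    | succ n ih =>
      rw [← Order.succ_eq_add_one, Order.Iio_succ_eq_insert, Set.image_insert_eq, ← ih]
      exact Finset.coe_insert _ _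
  refine ⟨fun n ↦ f (S n), fun n ↦ (hf _).1, fun n ↦ ?_, fun n t ht htB ↦ ?_⟩
  · rw [← hS]
    exact (hf _).2.1
  · rw [← hS] at ht ⊢
    refine (hf _).2.2 t ?_ htB
    rw [← Finset.coe_insert]
    exact ht

/-- A sequence of square roots, none contained in the field generated by its predecessors, is
independent with respect to generation of fields. -/
lemma notMem_adjoin_image_of_notMem {F E : Type*} [Field F] [Field E] [Algebra F E] {x : ℕ → E}
    (hx : ∀ n, ∃ c : F, x n ^ 2 = algebraMap F E c) (hx' : ∀ n, x n ∉ adjoin F (x '' Set.Iio n))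
    (T : Finset ℕ) : ∀ i ∉ T, x i ∉ adjoin F (x '' T) := by
  induction T using Finset.induction_on_max with
  | empty =>
    intro i _ h
    exact hx' i (adjoin.mono F _ _ (by simp) h)
  | insert m T hm ih =>
    intro i hi h
    rw [Finset.mem_insert, not_or] at hi
    -- If i < m, exchange puts `x m` in a field generated by earlier roots; if m < i, all of `insert
    -- m T` already lies below i.
    rcases lt_or_gt_of_ne hi.1 with him | him
    · obtain ⟨c, hc⟩ := hx m
      have hm2 : x m ^ 2 ∈ adjoin F (x '' T) := hc ▸ IntermediateField.algebraMap_mem _ c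
      rw [Finset.coe_insert, Set.image_insert_eq] at h
      refine hx' m (adjoin.mono F _ _ ?_
        (mem_adjoin_insert_of_mem_adjoin_insert_sqrt hm2 h (ih i hi.2)))
      exact Set.insert_subset (Set.mem_image_of_mem _ him) (Set.image_mono fun j hj ↦ hm j hj)
    · refine hx' i (adjoin.mono F _ _ (Set.image_mono fun j hj ↦ ?_) h)
      rcases Finset.mem_insert.mp hj with rfl | hj
      · exact him
      · exact (hm j hj).trans him

lemma exists_finset_of_mem_adjoin_image {F E : Type*} [Field F] [Field E] [Algebra F E] {x : ℕ → E}
    {S : Set ℕ} {t : E} (ht : t ∈ adjoin F (x '' S)) :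
    ∃ T : Finset ℕ, (T : Set ℕ) ⊆ S ∧ t ∈ adjoin F (x '' T) := by
  classical
  obtain ⟨U, hU, htU⟩ := exists_finset_of_mem_adjoin ht
  obtain ⟨T, hT, rfl⟩ := Finset.subset_set_image_iff.mp hU
  exact ⟨T, hT, by simpa using htU⟩

lemma adjoin_image_injective {F E : Type*} [Field F] [Field E] [Algebra F E] {x : ℕ → E}
    (hx : ∀ n, ∃ c : F, x n ^ 2 = algebraMap F E c) (hx' : ∀ n, x n ∉ adjoin F (x '' Set.Iio n)) :
    Function.Injective fun S : Set ℕ ↦ adjoin F (x '' S) := by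
  have key (S : Set ℕ) (i : ℕ) : x i ∈ adjoin F (x '' S) ↔ i ∈ S := by
    refine ⟨fun h ↦ ?_, fun h ↦ subset_adjoin F _ (Set.mem_image_of_mem x h)⟩
    obtain ⟨T, hT, h⟩ := exists_finset_of_mem_adjoin_image h
    by_contra hi
    exact notMem_adjoin_image_of_notMem hx hx' T i (fun h ↦ hi (hT h)) h
  intro S S' h
  ext i
  rw [← key S, ← key S']
  exact (congrArg (x i ∈ ·) h).to_iff

lemma finite_height_le_adjoin_image [Algebra.IsAlgebraic K Ω] {B : ℝ} {x : ℕ → Ω}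
    (hx : ∀ n, ∀ t ∈ adjoin K (x '' Set.Iio (n + 1)), absLogHeight₁ t ≤ B →
      t ∈ adjoin K (x '' Set.Iio n)) (S : Set ℕ) :
    {t : Ω | t ∈ adjoin K (x '' S) ∧ absLogHeight₁ t ≤ B}.Finite := by
  have := finiteDimensional_adjoin_of_finite (K := K) (Ω := Ω) Set.finite_empty
  refine (finite_absLogHeight₁_le Ω (Module.finrank ℚ (adjoin K (∅ : Set Ω)) * 2) B).subset ?_
  rintro t ⟨ht, htB⟩
  obtain ⟨T, -, ht⟩ := exists_finset_of_mem_adjoin_image ht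
  obtain ⟨n, hn⟩ := T.bddAbove
  have hmem (n : ℕ) : t ∈ adjoin K (x '' Set.Iio n) → t ∈ adjoin K (∅ : Set Ω) := by
    induction n with
    | zero => simp
    | succ n ih => exact fun h ↦ ih (hx n t h htB)
  have h0 := hmem (n + 1) (adjoin.mono K _ _
    (Set.image_mono fun j hj ↦ Nat.lt_succ_of_le (hn hj)) ht)
  -- The trivial root `y = 0` turns the quadratic degree bound into one for elements of K itself.
  obtain ⟨h1, h2⟩ := finrank_rat_adjoin_le_of_mem_adjoin_insert_sqrt (y := 0)
    (by simp) (adjoin.mono K _ _ (Set.subset_insert _ _) h0)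
  exact ⟨h1, h2, htB⟩

end tower

theorem mainTheorem6 (C : ℝ) (hC : 0 < C) (K : Type*) [Field K] [NumberField K] :
    ¬ {F : IntermediateField K (AlgebraicClosure K) |
        ENNReal.ofReal C < northcottNumber (F : Set (AlgebraicClosure K))}.Countable := by
  obtain ⟨x, hx, hx', hxB⟩ := exists_seq_sqrt (K := K) (Ω := AlgebraicClosure K) (C + 1)
  intro hcount
  have huniv : (Set.univ : Set (Set ℕ)).Countable :=
    (hcount.preimage (adjoin_image_injective hx hx')).mono fun S _ ↦
      lt_northcottNumberWith_of_finite hC.le (lt_add_one C) (finite_height_le_adjoin_image hxB S)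
  have := Set.countable_univ_iff.mp huniv
  obtain ⟨g, hg⟩ := exists_injective_nat (Set ℕ)
  exact Function.cantor_injective g hg
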